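/- Let $R$ be a noetherian commutative ring, $n\ge 0$, and let $I\unlhd R[\![t]\!][x_1,\ldots,x_n]$ be an $x$-homogeneous ideal, i.e. an ideal generated by elements that are homogeneous in $x=(x_1,\ldots,x_n)$ over $R[\![t]\!]$. A $t$-local monomial ordering is a total ordering $>$ on the monomials $t^\beta x^\alpha$ ($\beta\in\mathbb N$, $\alpha\in\mathbb N^n$) that is compatible with multiplication and satisfies $1>t$. For such an ordering let $\mathrm{lt}_>(I)\unlhd R[t,x]$ be the ideal generated by the leading terms $\mathrm{lt}_>(f)$, $f\in I$, where $\mathrm{lt}_>(f)$ is the term of $f\neq 0$ at its greatest monomial and $\mathrm{lt}_>(0)=0$. For $u=(u_0,\ldots,u_n)\in\mathbb R^{n+1}$ let $\mathrm{in}_u(f)$ be the sum of those terms $c\,t^\beta x^\alpha$ of $f$ for which $u\cdot(\beta,\alpha)$ is maximal; here $u_0<0$ and $f\in R[\![t]\!][x]$, or $u$ is arbitrary and $f\in R[t,x]$. For an ideal $J$ of $R[\![t]\!][x]$ (with $u_0<0$) or of $R[t,x]$, let $\mathrm{in}_u(J)\unlhd R[t,x]$ be the ideal generated by all $\mathrm{in}_u(f)$,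 $f\in J$. Finally let $$C_>(I)=\overline{\{u\in\mathbb R_{<0}\times\mathbb R^n \mid \mathrm{in}_u(I)=\mathrm{lt}_>(I)\}}\subseteq\mathbb R_{\le 0}\times\mathbb R^n$$ (Euclidean closure). Let $>$ be a $t$-local monomial ordering, $w\in C_>(I)$ with $w_0<0$, and $v\in\mathbb R^{n+1}$. Let $>_{(w,v)}$ be the $t$-local monomial ordering that compares $t^\beta x^\alpha$ and $t^{\beta'}x^{\alpha'}$ first by the values $w\cdot(\beta,\alpha)$ and $w\cdot(\beta',\alpha')$, in case of equality by $v\cdot(\beta,\alpha)$ and $v\cdot(\beta',\alpha')$, and if these are equal too by $>$. Then $$w\in C_>(I)\cap C_{>_{(w,v)}}(I),$$ and there is $\varepsilon_0>0$ such that for all $\varepsilon$ with $0<\varepsilon<\varepsilon_0$ we have $w_0+\varepsilon v_0<0$, $$w+\varepsilon v\in C_{>_{(w,v)}}(I)\qquad\text{and}\qquad \mathrm{in}_{w+\varepsilon v}(I)=\mathrm{in}_v(\mathrm{in}_w(I)).$$ -/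

import Mathlib

noncomputable section

namespace GroebnerFan

/-- The ring `R⟦t⟧[x₁, …, xₙ]`. -/
abbrev SerPoly (R : Type*) [CommRing R] (n : ℕ) := MvPolynomial (Fin n) (PowerSeries R)

/-- The polynomial ring `R[t, x₁, …, xₙ]`, written as `R[t][x₁, …, xₙ]`. -/
abbrev TPoly (R : Type*) [CommRing R] (n : ℕ) := MvPolynomial (Fin n) (Polynomial R)

/-- The semigroup of monomials in `t` and `x`, written additively: the pair `(β, α)` is the
monomial `t ^ β * x ^ α`. -/
abbrev Mon (n : ℕ) := ℕ × (Fin n →₀ ℕ)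

/-- The weight `w · (β, α) = w₀ β + w₁ α₁ + ⋯ + wₙ αₙ`. -/
def wdeg {n : ℕ} (w : Fin (n + 1) → ℝ) (m : Mon n) : ℝ :=
  w 0 * (m.1 : ℝ) + ∑ i : Fin n, w i.succ * (m.2 i : ℝ)

/-- A `t`-local monomial ordering: a (strict) total ordering `>` on the monomials that is
compatible with multiplication and satisfies `1 > t`. -/
structure TLocalOrdering (n : ℕ) where
  /-- `gt a b` means `a > b`. -/
  gt : Mon n → Mon n → Prop
  irrefl : ∀ a, ¬ gt a a
  trans : ∀ a b c, gt a b → gt b c → gt a c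
  total : ∀ a b, a ≠ b → gt a b ∨ gt b a
  mul_compat : ∀ a b c, gt a b → gt (a + c) (b + c)
  one_gt_t : gt 0 (1, 0)

theorem wdeg_add {n : ℕ} (w : Fin (n + 1) → ℝ) (a b : Mon n) :
    wdeg w (a + b) = wdeg w a + wdeg w b := by
  simp only [wdeg, Prod.fst_add, Prod.snd_add, Finsupp.add_apply, Nat.cast_add, mul_add,
    Finset.sum_add_distrib]
  ring

/-- The ordering `>_{(w,v)}`: compare the `w`-weights first, then the `v`-weights, and break the
remaining ties with `>`. It is `t`-local since `w₀ < 0`. -/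
def TLocalOrdering.refine {n : ℕ} (o : TLocalOrdering n) (w v : Fin (n + 1) → ℝ)
    (hw : w 0 < 0) : TLocalOrdering n where
  gt a b :=
    wdeg w a > wdeg w b ∨
    (wdeg w a = wdeg w b ∧ wdeg v a > wdeg v b) ∨
    (wdeg w a = wdeg w b ∧ wdeg v a = wdeg v b ∧ o.gt a b)
  irrefl a := by
    have := o.irrefl a
    simp [this]
  trans a b c := by
    rintro (h1 | ⟨h1, h2⟩ | ⟨h1, h2, h3⟩) (k1 | ⟨k1, k2⟩ | ⟨k1, k2, k3⟩)
    · left; linarith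
    · left; linarith
    · left; linarith
    · left; linarith
    · right; left; constructor <;> linarith
    · right; left; constructor <;> linarith
    · left; linarith
    · right; left; constructor <;> linarith
    · right; right; exact ⟨h1.trans k1, h2.trans k2, o.trans _ _ _ h3 k3⟩
  total a b hab := by
    rcases lt_trichotomy (wdeg w a) (wdeg w b) with h | h | h
    · right; left; exact h
    · rcases lt_trichotomy (wdeg v a) (wdeg v b) with k | k | k
      · right; right; left; exact ⟨h.symm, k⟩
      · rcases o.total a b hab with l | l
        · left; right; right; exact ⟨h, k, l⟩
        · right; right; right; exact ⟨h.symm, k.symm, l⟩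
      · left; right; left; exact ⟨h, k⟩
    · left; left; exact h
  mul_compat a b c := by
    rintro (h1 | ⟨h1, h2⟩ | ⟨h1, h2, h3⟩)
    · left; rw [wdeg_add, wdeg_add]; linarith
    · right; left; simp only [wdeg_add]; constructor <;> linarith
    · right; right; simp only [wdeg_add]
      exact ⟨by linarith, by linarith, o.mul_compat _ _ _ h3⟩
  one_gt_t := by
    left
    simpa [wdeg] using hw

variable {R : Type*} [CommRing R] {n : ℕ}

/-- The coefficient of `t ^ β * x ^ α` in an element of `R⟦t⟧[x]`. -/
def serCoeff (f : SerPoly R n) (m : Mon n) : R :=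
  PowerSeries.coeff m.1 (MvPolynomial.coeff m.2 f)

/-- The coefficient of `t ^ β * x ^ α` in an element of `R[t, x]`. -/
def polyCoeff (f : TPoly R n) (m : Mon n) : R :=
  (MvPolynomial.coeff m.2 f).coeff m.1

/-- The term `c * t ^ β * x ^ α` in `R[t, x]`. -/
def monTerm (m : Mon n) (c : R) : TPoly R n :=
  MvPolynomial.monomial m.2 (Polynomial.monomial m.1 c)

/-- Given the coefficients `c` of an element `f`, the monomials occurring in `f` whose `w`-weight
is maximal among all monomials occurring in `f`. -/
def topExponents (w : Fin (n + 1) → ℝ) (c : Mon n → R) : Set (Mon n) :=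
  {m | c m ≠ 0 ∧ ∀ m', c m' ≠ 0 → wdeg w m' ≤ wdeg w m}

/-- The initial form with respect to `w` of the element with coefficients `c`: the sum of its terms
of maximal `w`-weight. This is a finite sum for `f ∈ R⟦t⟧[x]` and `w₀ < 0`, and for `f ∈ R[t, x]`
and all `w`. -/
def initialForm (w : Fin (n + 1) → ℝ) (c : Mon n → R) : TPoly R n :=
  ∑ᶠ m ∈ topExponents w c, monTerm m (c m)

/-- For `w₀ < 0` the initial form of an element of `R⟦t⟧[x]` has finitely many terms. -/
theorem topExponents_serCoeff_finite (w : Fin (n + 1) → ℝ) (hw : w 0 < 0) (f : SerPoly R n) :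
    (topExponents w (serCoeff f)).Finite := by
  refine Set.Finite.of_finite_image (f := Prod.snd) ?_ ?_
  · refine f.support.finite_toSet.subset ?_
    rintro _ ⟨m, hm, rfl⟩
    simp only [Finset.mem_coe, MvPolynomial.mem_support_iff]
    intro h
    apply hm.1
    simp [serCoeff, h]
  · rintro ⟨a, α⟩ ha ⟨b, β⟩ hb hab
    obtain rfl : α = β := hab
    have h1 := ha.2 _ hb.1
    have h2 := hb.2 _ ha.1
    have h3 : w 0 * (a : ℝ) = w 0 * (b : ℝ) := by
      simp only [wdeg] at h1 h2; linarith
    have h4 : (a : ℝ) = b := mul_left_cancel₀ hw.ne h3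
    rw [Nat.cast_inj.mp h4]

/-- Elements of `R[t, x]` have finitely many terms. -/
theorem topExponents_polyCoeff_finite (w : Fin (n + 1) → ℝ) (f : TPoly R n) :
    (topExponents w (polyCoeff f)).Finite := by
  refine (Set.Finite.subset (f.support.biUnion fun α =>
    (MvPolynomial.coeff α f).support ×ˢ {α}).finite_toSet ?_)
  rintro ⟨b, α⟩ hm
  have h : (MvPolynomial.coeff α f).coeff b ≠ 0 := hm.1
  simp only [Finset.mem_coe, Finset.mem_biUnion, Finset.mem_product, Finset.mem_singleton,
    MvPolynomial.mem_support_iff, Polynomial.mem_support_iff]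
  refine ⟨α, ?_, h, rfl⟩
  intro h0
  simp [h0] at h

/-- The initial ideal `in_w(I) ⊆ R[t, x]` of an ideal `I` of `R⟦t⟧[x]`, for `w₀ < 0`. -/
def initialIdeal (w : Fin (n + 1) → ℝ) (I : Ideal (SerPoly R n)) : Ideal (TPoly R n) :=
  Ideal.span {h | ∃ f ∈ I, h = initialForm w (serCoeff f)}

/-- The initial ideal `in_v(J) ⊆ R[t, x]` of an ideal `J` of `R[t, x]`, for arbitrary `v`. -/
def polyInitialIdeal (v : Fin (n + 1) → ℝ) (J : Ideal (TPoly R n)) : Ideal (TPoly R n) :=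
  Ideal.span {h | ∃ f ∈ J, h = initialForm v (polyCoeff f)}

/-- The leading term of the element with coefficients `c`: the term at its greatest monomial.
The sum has at most one summand, and none exactly if the element is zero. -/
def leadingTerm (o : TLocalOrdering n) (c : Mon n → R) : TPoly R n :=
  ∑ᶠ m ∈ {m | c m ≠ 0 ∧ ∀ m', c m' ≠ 0 → m' ≠ m → o.gt m m'}, monTerm m (c m)

/-- The leading ideal `lt_>(I) ⊆ R[t, x]` of an ideal `I` of `R⟦t⟧[x]`. -/
def leadingIdeal (o : TLocalOrdering n) (I : Ideal (SerPoly R n)) : Ideal (TPoly R n) :=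
  Ideal.span {h | ∃ f ∈ I, h = leadingTerm o (serCoeff f)}

/-- The cone `C_>(I)`: the Euclidean closure of the set of weight vectors `u` with `u₀ < 0` and
`in_u(I) = lt_>(I)`. -/
def groebnerCone (o : TLocalOrdering n) (I : Ideal (SerPoly R n)) : Set (Fin (n + 1) → ℝ) :=
  closure {u | u 0 < 0 ∧ initialIdeal u I = leadingIdeal o I}

/-- An ideal of `R⟦t⟧[x]` is `x`-homogeneous if it is generated by `x`-homogeneous elements. -/
def IsXHomogeneous (I : Ideal (SerPoly R n)) : Prop :=
  ∃ S : Set (SerPoly R n), (∀ f ∈ S, ∃ d : ℕ, MvPolynomial.IsHomogeneous f d) ∧ I = Ideal.span S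

end GroebnerFan

end

open Filter Topology

namespace GroebnerFan

/-! Both equalities of ideals behind the theorem, in_{w+εv}(I) = in_v(in_w(I)) and in_u(I) = lt(I)
for the refined ordering and suitable u near w + εv, split into an easy inclusion and a formal
converse.

The inclusions into the initial ideal are finiteness statements. `R[t, x]` is noetherian, so
finitely many generators suffice; each comes from elements of `I`, and since u₀ < 0 only the lowest
power of t beside each x-exponent matters. Finitely many strict inequalities remain. For
in_v(in_w(I)) they hold once ε is small (`eventually_polyInitialIdeal_le`). For the leading ideal
(`exists_finset_leadingIdeal_le`) they hold at w + εv + δu for small δ, where u realises the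
comparisons left to the tie-breaking ordering and exists by Gordan's theorem (`exists_wdeg_lt`).
Letting δ → 0 puts w + εv into the closed cone.

The converses need neither division with remainder nor standard bases. In a fixed x-degree only
finitely many monomials lie above a given one, so each ordering becomes a ranking by natural
numbers. If all top parts for the ranking lift to top parts for the weight, then subtracting lifts,
by induction on the rank, shows that the strata of the weight-top parts are themselves top parts for
the ranking (`exists_mem_vanishing_above`). `initialIdeal_le_of_le` turns this into an inclusion of
ideals. -/

/-! ### Exchanging two stratifications -/

/-- Let `N` be a group of families, with the indices stratified by `ψ` and, more finely, by `ρ`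
(a smaller rank being higher). If the top part with respect to `ρ` of every member of `N` is a top
part with respect to `ψ` of some member, then conversely the `ρ`-strata of the top parts with
respect to `ψ` are top parts with respect to `ρ`. -/
theorem exists_mem_vanishing_above {X A : Type*} [AddCommGroup A] (N : AddSubgroup (X → A))
    (ρ : X → ℕ) (ψ : X → ℝ) (hρψ : ∀ x y, ρ x = ρ y → ψ x = ψ y)
    (H : ∀ f ∈ N, ∀ s, (∀ x, ρ x < ρ s → f x = 0) →
      ∃ g ∈ N, (∀ x, ψ s < ψ x → g x = 0) ∧
        ∀ x, ψ x = ψ s → (ρ x = ρ s → g x = f x) ∧ (ρ x ≠ ρ s → g x = 0))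
    {f : X → A} (hf : f ∈ N) (s : X) (hfs : ∀ x, ψ s < ψ x → f x = 0) :
    ∃ g ∈ N, (∀ x, ρ x < ρ s → g x = 0) ∧ ∀ x, ρ x = ρ s → g x = f x := by
  -- The induction runs on the rank bound `j`, so no well-foundedness of `ψ` is needed. `f` and `σ`
  -- stay universally quantified because the hypothesis is also applied to a correction term at a
  -- lower level.
  have lift : ∀ j : ℕ, ∀ f ∈ N, ∀ σ : ℝ, (∀ x, σ < ψ x → f x = 0) →
      (∀ x, ψ x = σ → ρ x < j → f x = 0) →
      ∃ g ∈ N, (∀ x, σ < ψ x → g x = 0) ∧ (∀ x, ψ x = σ → g x = f x) ∧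
        ∀ x, ρ x < j → g x = 0 := by
    intro j
    induction j with
    | zero => intro f hf σ h _; exact ⟨f, hf, h, fun _ _ => rfl, by simp⟩
    | succ j ih =>
      intro f hf σ h1 h2
      obtain ⟨g, hg, g1, g2, g3⟩ := ih f hf σ h1 fun x hx hj => h2 x hx (by omega)
      by_cases hs : ∃ s, ρ s = j ∧ g s ≠ 0
      · obtain ⟨s, rfl, hgs⟩ := hs
        have hlt : ψ s < σ := by
          rcases lt_trichotomy (ψ s) σ with h | h | h
          · exact h
          · exact absurd ((g2 s h).trans (h2 s h (by omega))) hgs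
          · exact absurd (g1 s h) hgs
        -- The rank-`j` stratum of `g` is the whole top level of some `k`, strictly below `σ`.
        -- Clearing the ranks below `j` from `k` keeps that level, so subtracting kills rank `j` and
        -- leaves level `σ` alone.
        obtain ⟨k, hk, k1, k2⟩ := H g hg s g3
        obtain ⟨l, hl, l1, l2, l3⟩ := ih k hk (ψ s) k1 fun x hx hj => (k2 x hx).2 hj.ne
        refine ⟨g - l, N.sub_mem hg hl, fun x hx => ?_, fun x hx => ?_, fun x hx => ?_⟩
        · simp [g1 x hx, l1 x (hlt.trans hx)]
        · simp [g2 x hx, l1 x (hx ▸ hlt)]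
        · rcases Nat.lt_succ_iff_lt_or_eq.mp hx with h | h
          · simp [g3 x h, l3 x h]
          · simp [l2 x (hρψ _ _ h), (k2 x (hρψ _ _ h)).1 h]
      · push Not at hs
        refine ⟨g, hg, g1, g2, fun x hx => ?_⟩
        rcases Nat.lt_succ_iff_lt_or_eq.mp hx with h | h
        · exact g3 x h
        · exact hs x h
  -- Within the level of `s`, the strata of rank below `ρ s` are removed one at a time; a final
  -- `lift` then clears these ranks at the lower levels.
  have strip : ∀ j ≤ ρ s, ∃ g ∈ N, (∀ x, ψ s < ψ x → g x = 0) ∧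
      ∀ x, ψ x = ψ s → (ρ x < j → g x = 0) ∧ (j ≤ ρ x → g x = f x) := by
    intro j
    induction j with
    | zero => exact fun _ => ⟨f, hf, hfs, by simp⟩
    | succ j ih =>
      intro hj
      obtain ⟨g, hg, g1, g2⟩ := ih (by omega)
      obtain ⟨l, hl, l1, l2, l3⟩ := lift j g hg (ψ s) g1 fun x hx h => (g2 x hx).1 h
      by_cases hs : ∃ s', ρ s' = j ∧ ψ s' = ψ s
      · obtain ⟨s', rfl, hs'⟩ := hs
        obtain ⟨k, hk, k1, k2⟩ := H l hl s' l3
        rw [hs'] at k1 k2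
        refine ⟨g - k, N.sub_mem hg hk, fun x hx => ?_, fun x hx => ⟨fun h => ?_, fun h => ?_⟩⟩
        · simp [g1 x hx, k1 x hx]
        · rcases Nat.lt_succ_iff_lt_or_eq.mp h with h | h
          · simp [(g2 x hx).1 h, (k2 x hx).2 h.ne]
          · simp [(k2 x hx).1 h, l2 x hx]
        · simp [(g2 x hx).2 (by omega), (k2 x hx).2 (by omega)]
      · push Not at hs
        refine ⟨g, hg, g1, fun x hx => ⟨fun h => ?_, fun h => (g2 x hx).2 (by omega)⟩⟩
        rcases Nat.lt_succ_iff_lt_or_eq.mp h with h | h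
        · exact (g2 x hx).1 h
        · exact absurd hx (hs x h)
  obtain ⟨g, hg, g1, g2⟩ := strip (ρ s) le_rfl
  obtain ⟨l, hl, -, l2, l3⟩ := lift (ρ s) g hg (ψ s) g1 fun x hx h => (g2 x hx).1 h
  refine ⟨l, hl, l3, fun x hx => ?_⟩
  have hx' := hρψ _ _ hx
  rw [l2 x hx', (g2 x hx').2 hx.ge]

/-! ### Weight vectors realising finitely many comparisons -/

/-- Gordan's theorem over an ordered field, for finitely many vectors in a pointed cone. -/
theorem exists_linearMap_pos {K V : Type*} [Field K] [LinearOrder K] [IsStrictOrderedRing K]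
    [AddCommGroup V] [Module K V] (P : Set V) (hadd : ∀ x ∈ P, ∀ y ∈ P, x + y ∈ P)
    (hsmul : ∀ c : K, 0 < c → ∀ x ∈ P, c • x ∈ P) (h0 : (0 : V) ∉ P) (m : ℕ) (d : Fin m → V)
    (hd : ∀ i, d i ∈ P) : ∃ f : V →ₗ[K] K, ∀ i, 0 < f (d i) := by
  induction m with
  | zero => exact ⟨0, fun i => i.elim0⟩
  | succ m ih =>
    obtain ⟨f, hf⟩ := ih (fun i => d i.succ) fun i => hd _
    rcases lt_trichotomy (f (d 0)) 0 with hfe | hfe | hfe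
    -- Fourier–Motzkin elimination: these positive combinations lie in the kernel of `f`. Positivity
    -- of `g` on them says exactly that the lower bounds on `c` for `g + c • f` are below the upper
    -- bound.
    · obtain ⟨g, hg⟩ := ih (fun i => (-f (d 0)) • d i.succ + f (d i.succ) • d 0) fun i =>
        hadd _ (hsmul _ (by linarith) _ (hd _)) _ (hsmul _ (hf i) _ (hd _))
      obtain ⟨c, hc1, hc2⟩ := Order.exists_between_finsets
        (Finset.univ.image fun i => -g (d (Fin.succ i)) / f (d i.succ)) {g (d 0) / -f (d 0)} (by
          intro x hx y hy
          simp only [Finset.mem_image, Finset.mem_univ, true_and, Finset.mem_singleton] at hx hy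
          obtain ⟨i, rfl⟩ := hx
          rw [hy, div_lt_div_iff₀ (hf i) (by linarith)]
          have := hg i
          simp only [map_add, map_smul, smul_eq_mul] at this
          linarith)
      refine ⟨g + c • f, Fin.cases ?_ fun i => ?_⟩
      · have := hc2 _ (Finset.mem_singleton_self _)
        rw [lt_div_iff₀ (by linarith)] at this
        simp only [LinearMap.add_apply, LinearMap.smul_apply, smul_eq_mul]
        linarith
      · have := hc1 _ (Finset.mem_image_of_mem _ (Finset.mem_univ i))
        rw [div_lt_iff₀ (hf i)] at this
        simp only [LinearMap.add_apply, LinearMap.smul_apply, smul_eq_mul]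
        linarith
    · obtain ⟨g, hg⟩ : ∃ g : V →ₗ[K] K, 0 < g (d 0) := by
        have hne : d 0 ≠ 0 := fun h => h0 (h ▸ hd 0)
        rw [Ne, ← Module.forall_dual_apply_eq_zero_iff K] at hne
        push Not at hne
        obtain ⟨g, hg⟩ := hne
        rcases lt_or_gt_of_ne hg with h | h
        · exact ⟨-g, by simpa using h⟩
        · exact ⟨g, h⟩
      obtain ⟨c, hc⟩ := (Finset.univ.image fun i => -g (d (Fin.succ i)) / f (d i.succ)).exists_le
      -- `c` bounds the quotients only weakly; adding 1 makes the inequalities strict.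
      refine ⟨g + (c + 1) • f, Fin.cases (by simpa [hfe] using hg) fun i => ?_⟩
      have := hc _ (Finset.mem_image_of_mem _ (Finset.mem_univ i))
      rw [div_le_iff₀ (hf i)] at this
      have := hf i
      simp only [LinearMap.add_apply, LinearMap.smul_apply, smul_eq_mul]
      linarith
    · exact ⟨f, Fin.cases hfe hf⟩

variable {R : Type*} [CommRing R] {n : ℕ}

namespace TLocalOrdering

variable (o : TLocalOrdering n)

theorem asymm {a b : Mon n} (h : o.gt a b) : ¬ o.gt b a :=
  fun h' => o.irrefl _ (o.trans _ _ _ h h')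

theorem gt_add {a b c d : Mon n} (h : o.gt a b) (h' : o.gt c d) : o.gt (a + c) (b + d) := by
  refine o.trans _ _ _ (o.mul_compat _ _ c h) ?_
  rw [add_comm b c, add_comm b d]
  exact o.mul_compat _ _ b h'

theorem gt_nsmul {a b : Mon n} (h : o.gt a b) {k : ℕ} (hk : 0 < k) : o.gt (k • a) (k • b) := by
  induction k, hk using Nat.le_induction with
  | base => simpa using h
  | succ k _ ih => rw [succ_nsmul, succ_nsmul]; exact o.gt_add ih h

end TLocalOrdering

/-- The exponent vector of a monomial, with rational entries. -/
def expVec (n : ℕ) : Mon n →+ (Fin (n + 1) → ℚ) where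
  toFun m := Fin.cons (m.1 : ℚ) fun i => (m.2 i : ℚ)
  map_zero' := by ext i; refine Fin.cases ?_ (fun i => ?_) i <;> simp
  map_add' a b := by ext i; refine Fin.cases ?_ (fun i => ?_) i <;> simp

theorem expVec_injective (n : ℕ) : Function.Injective (expVec n) := by
  intro a b h
  refine Prod.ext ?_ (Finsupp.ext fun i => ?_)
  · simpa [expVec] using congrFun h 0
  · simpa [expVec] using congrFun h i.succ

theorem wdeg_eq_expVec (f : (Fin (n + 1) → ℚ) →ₗ[ℚ] ℚ) (m : Mon n) :
    wdeg (fun i => (f (Pi.single i 1) : ℝ)) m = f (expVec n m) := by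
  have h (i : Fin (n + 1)) :
      (fun j => if i = j then (1 : ℚ) else 0) = Pi.single i 1 := by
    ext j; simp [Pi.single_apply, eq_comm]
  rw [f.pi_apply_eq_sum_univ (expVec n m), Fin.sum_univ_succ]
  simp [wdeg, expVec, mul_comm, h]

/-- Finitely many comparisons in a monomial ordering can be realised by a weight vector. -/
theorem exists_wdeg_lt (o : TLocalOrdering n) (D : Finset (Mon n × Mon n))
    (hD : ∀ p ∈ D, o.gt p.1 p.2) :
    ∃ u : Fin (n + 1) → ℝ, ∀ p ∈ D, wdeg u p.2 < wdeg u p.1 := by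
  -- Over ℚ, denominators can be cleared, so the differences a − b with a > b generate a cone
  -- described by the ordering alone. It omits 0 because the ordering is irreflexive.
  obtain ⟨f, hf⟩ := exists_linearMap_pos (K := ℚ)
    {x | ∃ k : ℕ, 0 < k ∧ ∃ a b, o.gt a b ∧ (k : ℚ) • x = expVec n a - expVec n b}
    (by
      rintro x ⟨k, hk, a, b, hab, hx⟩ y ⟨l, hl, c, d, hcd, hy⟩
      refine ⟨l * k, by positivity, l • a + k • c, l • b + k • d,
        o.gt_add (o.gt_nsmul hab hl) (o.gt_nsmul hcd hk), ?_⟩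
      have : ((l * k : ℕ) : ℚ) • (x + y) = (l : ℚ) • (k : ℚ) • x + (k : ℚ) • (l : ℚ) • y := by
        push_cast; module
      rw [this, hx, hy]
      simp only [map_add, map_nsmul, ← Nat.cast_smul_eq_nsmul ℚ]
      module)
    (by
      rintro c hc x ⟨k, hk, a, b, hab, hx⟩
      have hnum : (0 : ℤ) < c.num := Rat.num_pos.mpr hc
      refine ⟨c.den * k, Nat.mul_pos c.den_pos hk, c.num.toNat • a, c.num.toNat • b,
        o.gt_nsmul hab (by omega), ?_⟩
      have h1 : ((c.num.toNat : ℕ) : ℚ) = c.den * c := by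
        rw [Rat.den_mul_eq_num]; exact_mod_cast Int.toNat_of_nonneg hnum.le
      have : ((c.den * k : ℕ) : ℚ) • c • x = ((c.den : ℚ) * c) • (k : ℚ) • x := by
        push_cast; module
      rw [this, hx]
      simp only [map_nsmul, ← Nat.cast_smul_eq_nsmul ℚ, h1]
      module)
    (by
      rintro ⟨k, hk, a, b, hab, hx⟩
      rw [smul_zero, eq_comm, sub_eq_zero] at hx
      exact o.irrefl a (by simpa [expVec_injective n hx] using hab))
    D.card (fun i => expVec n (D.equivFin.symm i).1.1 - expVec n (D.equivFin.symm i).1.2)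
    fun i => ⟨1, one_pos, _, _, hD _ (D.equivFin.symm i).2, by simp⟩
  refine ⟨fun i => (f (Pi.single i 1) : ℝ), fun p hp => ?_⟩
  have := hf (D.equivFin ⟨p, hp⟩)
  rw [Equiv.symm_apply_apply, map_sub, sub_pos] at this
  rw [wdeg_eq_expVec, wdeg_eq_expVec]
  exact_mod_cast this

/-! ### Weights, coefficients and finite sums of terms -/

theorem wdeg_add_smul (w v : Fin (n + 1) → ℝ) (ε : ℝ) (m : Mon n) :
    wdeg (w + ε • v) m = wdeg w m + ε * wdeg v m := by
  simp only [wdeg, Pi.add_apply, Pi.smul_apply, smul_eq_mul, add_mul, Finset.sum_add_distrib,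
    mul_add, Finset.mul_sum, mul_assoc]
  ring

theorem wdeg_anti {u : Fin (n + 1) → ℝ} (hu : u 0 < 0) {b c : ℕ} (h : b < c) (α : Fin n →₀ ℕ) :
    wdeg u (c, α) < wdeg u (b, α) := by
  have : (b : ℝ) < c := by exact_mod_cast h
  simp only [wdeg]
  nlinarith

@[simp] theorem serCoeff_add (f g : SerPoly R n) (m : Mon n) :
    serCoeff (f + g) m = serCoeff f m + serCoeff g m := by simp [serCoeff]

@[simp] theorem serCoeff_neg (f : SerPoly R n) (m : Mon n) :
    serCoeff (-f) m = -serCoeff f m := by simp [serCoeff]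

@[simp] theorem serCoeff_zero (m : Mon n) : serCoeff (0 : SerPoly R n) m = 0 := by simp [serCoeff]

@[simp] theorem polyCoeff_add (f g : TPoly R n) (m : Mon n) :
    polyCoeff (f + g) m = polyCoeff f m + polyCoeff g m := by simp [polyCoeff]

@[simp] theorem polyCoeff_zero (m : Mon n) : polyCoeff (0 : TPoly R n) m = 0 := by
  simp [polyCoeff]

theorem polyCoeff_sum {ι : Type*} (s : Finset ι) (f : ι → TPoly R n) (m : Mon n) :
    polyCoeff (∑ i ∈ s, f i) m = ∑ i ∈ s, polyCoeff (f i) m := by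
  simp [polyCoeff, MvPolynomial.coeff_sum, Polynomial.finsetSum_coeff]

theorem polyCoeff_monTerm [DecidableEq (Mon n)] (m x : Mon n) (c : R) :
    polyCoeff (monTerm m c) x = if m = x then c else 0 := by
  classical
  simp only [polyCoeff, monTerm, MvPolynomial.coeff_monomial, Prod.ext_iff]
  by_cases h : m.2 = x.2 <;> simp [h, Polynomial.coeff_monomial]

@[simp] theorem monTerm_zero (m : Mon n) : monTerm m (0 : R) = 0 := by simp [monTerm]

theorem polyCoeff_sum_monTerm [DecidableEq (Mon n)] (s : Finset (Mon n)) (c : Mon n → R)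
    (x : Mon n) : polyCoeff (∑ m ∈ s, monTerm m (c m)) x = if x ∈ s then c x else 0 := by
  simp [polyCoeff_sum, polyCoeff_monTerm]

theorem finsum_mem_monTerm (c : Mon n → R) (A : Set (Mon n)) (s : Finset (Mon n))
    (h : ∀ m, c m ≠ 0 → (m ∈ A ↔ m ∈ s)) :
    ∑ᶠ m ∈ A, monTerm m (c m) = ∑ m ∈ s, monTerm m (c m) := by
  refine finsum_mem_eq_sum_of_inter_support_eq _ (Set.ext fun m => ?_)
  simp only [Set.mem_inter_iff, Function.mem_support, Finset.mem_coe]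
  refine and_congr_left fun hm => h m fun h0 => hm (by simp [h0])

theorem sum_monTerm_congr_support (c : Mon n → R) (s t : Finset (Mon n))
    (h : ∀ m, c m ≠ 0 → (m ∈ s ↔ m ∈ t)) :
    ∑ m ∈ s, monTerm m (c m) = ∑ m ∈ t, monTerm m (c m) := by
  rw [← finsum_mem_monTerm c s t (by simpa using h), finsum_mem_coe_finset]

/-- The part at a bound for the weights of the monomials is zero or the initial form. -/
theorem sum_monTerm_eq_zero_or_initialForm {u : Fin (n + 1) → ℝ} (c : Mon n → R)
    (s : Finset (Mon n)) (σ : ℝ) (hle : ∀ m, c m ≠ 0 → wdeg u m ≤ σ)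
    (hs : ∀ m, c m ≠ 0 → (m ∈ s ↔ wdeg u m = σ)) :
    ∑ m ∈ s, monTerm m (c m) = 0 ∨ ∑ m ∈ s, monTerm m (c m) = initialForm u c := by
  by_cases h : ∃ m ∈ s, c m ≠ 0
  · obtain ⟨m, hm, hm0⟩ := h
    refine Or.inr (finsum_mem_monTerm _ _ _ fun x hx => ?_).symm
    rw [hs x hx]
    refine ⟨fun h => le_antisymm (hle x hx) ?_, fun h => ⟨hx, fun y hy => h ▸ hle y hy⟩⟩
    rw [← (hs m hm0).1 hm]
    exact h.2 m hm0
  · push Not at h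
    exact Or.inl (Finset.sum_eq_zero fun m hm => by simp [h m hm])

theorem sum_monTerm_mem_initialIdeal {u : Fin (n + 1) → ℝ} {I : Ideal (SerPoly R n)}
    {f : SerPoly R n} (hf : f ∈ I) (s : Finset (Mon n)) (σ : ℝ)
    (hle : ∀ m, serCoeff f m ≠ 0 → wdeg u m ≤ σ)
    (hs : ∀ m, serCoeff f m ≠ 0 → (m ∈ s ↔ wdeg u m = σ)) :
    ∑ m ∈ s, monTerm m (serCoeff f m) ∈ initialIdeal u I := by
  rcases sum_monTerm_eq_zero_or_initialForm _ s σ hle hs with h | h <;> rw [h]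
  · exact zero_mem _
  · exact Ideal.subset_span ⟨f, hf, rfl⟩

theorem sum_monTerm_mem_polyInitialIdeal {u : Fin (n + 1) → ℝ} {J : Ideal (TPoly R n)}
    {f : TPoly R n} (hf : f ∈ J) (s : Finset (Mon n)) (σ : ℝ)
    (hle : ∀ m, polyCoeff f m ≠ 0 → wdeg u m ≤ σ)
    (hs : ∀ m, polyCoeff f m ≠ 0 → (m ∈ s ↔ wdeg u m = σ)) :
    ∑ m ∈ s, monTerm m (polyCoeff f m) ∈ polyInitialIdeal u J := by
  rcases sum_monTerm_eq_zero_or_initialForm _ s σ hle hs with h | h <;> rw [h]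
  · exact zero_mem _
  · exact Ideal.subset_span ⟨f, hf, rfl⟩

/-! ### Lifting elements of the initial ideal -/

/-- The inclusion `R[t, x] → R⟦t⟧[x]`. -/
noncomputable def toSer : TPoly R n →+* SerPoly R n :=
  MvPolynomial.map Polynomial.coeToPowerSeries.ringHom

theorem serCoeff_toSer (f : TPoly R n) (m : Mon n) : serCoeff (toSer f) m = polyCoeff f m := by
  simp [serCoeff, toSer, polyCoeff, MvPolynomial.coeff_map]

theorem serCoeff_toSer_monTerm_mul (a : Mon n) (c : R) (f : SerPoly R n) (m : Mon n) :
    serCoeff (toSer (monTerm a c) * f) m = if a ≤ m then c * serCoeff f (m - a) else 0 := by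
  classical
  have : toSer (monTerm a c) =
      MvPolynomial.monomial a.2 (PowerSeries.X ^ a.1 * PowerSeries.C c) := by
    rw [toSer, monTerm, MvPolynomial.map_monomial, ← Polynomial.C_mul_X_pow_eq_monomial]
    simp only [map_mul, map_pow, Polynomial.coeToPowerSeries.ringHom_apply, Polynomial.coe_C,
      Polynomial.coe_X, mul_comm]
  rw [this, serCoeff, MvPolynomial.coeff_monomial_mul']
  by_cases h2 : a.2 ≤ m.2
  · by_cases h1 : a.1 ≤ m.1
    · simp [h1, h2, Prod.le_def, mul_assoc, PowerSeries.coeff_X_pow_mul', serCoeff]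
    · simp [h1, h2, Prod.le_def, mul_assoc, PowerSeries.coeff_X_pow_mul']
  · simp [h2, Prod.le_def]

theorem induction_monTerm {p : TPoly R n → Prop} (q : TPoly R n)
    (hadd : ∀ a b, p a → p b → p (a + b)) (hmon : ∀ m c, p (monTerm m c)) : p q := by
  induction q using MvPolynomial.induction_on' with
  | monomial α r =>
    induction r using Polynomial.induction_on' with
    | add r s hr hs => rw [map_add]; exact hadd _ _ hr hs
    | monomial b c => exact hmon (b, α) c
  | add a b ha hb => exact hadd _ _ ha hb

/-- This is how homogeneity of `I` is used: every argument can be carried out in a single x-degree.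
-/
theorem IsXHomogeneous.homogeneousComponent_mem {I : Ideal (SerPoly R n)} (hI : IsXHomogeneous I)
    {f : SerPoly R n} (hf : f ∈ I) (d : ℕ) : MvPolynomial.homogeneousComponent d f ∈ I := by
  obtain ⟨S, hS, rfl⟩ := hI
  let _ := MvPolynomial.gradedAlgebra (σ := Fin n) (R := PowerSeries R)
  refine MvPolynomial.homogeneousComponent_mem_of_mem (Ideal.homogeneous_span _ _ fun x hx => ?_) hf d
  obtain ⟨d, hd⟩ := hS x hx
  exact ⟨d, hd⟩

theorem degree_eq_of_serCoeff_ne_zero {f : SerPoly R n} {d : ℕ} (hf : f.IsHomogeneous d)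
    {m : Mon n} (h : serCoeff f m ≠ 0) : m.2.degree = d := by
  by_contra hd
  exact h (by simp [serCoeff, hf.coeff_eq_zero hd])

theorem serCoeff_homogeneousComponent (f : SerPoly R n) (d : ℕ) (m : Mon n) :
    serCoeff (MvPolynomial.homogeneousComponent d f) m =
      if m.2.degree = d then serCoeff f m else 0 := by
  rw [serCoeff, MvPolynomial.coeff_homogeneousComponent]
  split_ifs <;> simp [serCoeff]

/-- Every bihomogeneous component of an element of `in_u(I)` is the top part of an `x`-homogeneous
element of `I`. -/
theorem exists_mem_of_mem_initialIdeal {u : Fin (n + 1) → ℝ} (hu : u 0 < 0)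
    {I : Ideal (SerPoly R n)} (hI : IsXHomogeneous I) {h : TPoly R n} (hh : h ∈ initialIdeal u I) :
    ∀ (σ : ℝ) (d : ℕ), ∃ f ∈ I, f.IsHomogeneous d ∧ (∀ m, σ < wdeg u m → serCoeff f m = 0) ∧
      ∀ m, m.2.degree = d → wdeg u m = σ → serCoeff f m = polyCoeff h m := by
  classical
  induction hh using Submodule.span_induction with
  | zero =>
    exact fun σ d => ⟨0, zero_mem _, MvPolynomial.isHomogeneous_zero _ _ _, by simp, by simp⟩
  | add a b _ _ ha hb =>
    intro σ d
    obtain ⟨f, hf, f1, f2, f3⟩ := ha σ d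
    obtain ⟨g, hg, g1, g2, g3⟩ := hb σ d
    refine ⟨f + g, add_mem hf hg, f1.add g1, fun m hm => ?_, fun m hm hm' => ?_⟩
    · simp [f2 m hm, g2 m hm]
    · simp [f3 m hm hm', g3 m hm hm']
  | mem h hh =>
    obtain ⟨f, hf, rfl⟩ := hh
    intro σ d
    have hfin := topExponents_serCoeff_finite u hu f
    have hco (m : Mon n) : polyCoeff (initialForm u (serCoeff f)) m =
        if m ∈ topExponents u (serCoeff f) then serCoeff f m else 0 := by
      rw [initialForm, finsum_mem_monTerm _ _ hfin.toFinset (by simp), polyCoeff_sum_monTerm]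
      simp
    by_cases hσ : ∃ m ∈ topExponents u (serCoeff f), wdeg u m = σ
    · obtain ⟨m₀, hm₀, rfl⟩ := hσ
      refine ⟨_, hI.homogeneousComponent_mem hf d,
        MvPolynomial.homogeneousComponent_isHomogeneous d f, fun m hm => ?_, fun m hm hm' => ?_⟩
      · rw [serCoeff_homogeneousComponent]
        have : serCoeff f m = 0 := by
          by_contra h
          exact absurd (hm₀.2 m h) (not_le.mpr hm)
        simp [this]
      · rw [serCoeff_homogeneousComponent, if_pos hm, hco]
        split_ifs with h
        · rfl
        · by_contra h0
          exact h ⟨h0, fun y hy => hm' ▸ hm₀.2 y hy⟩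
    · push Not at hσ
      refine ⟨0, zero_mem _, MvPolynomial.isHomogeneous_zero _ _ _, by simp, fun m _ hm => ?_⟩
      rw [hco, if_neg fun h => hσ m h hm, serCoeff_zero]
  | smul q h _ ih =>
    induction q using induction_monTerm with
    | hadd a b ha hb =>
      intro σ d
      obtain ⟨f, hf, f1, f2, f3⟩ := ha σ d
      obtain ⟨g, hg, g1, g2, g3⟩ := hb σ d
      refine ⟨f + g, add_mem hf hg, f1.add g1, fun m hm => ?_, fun m hm hm' => ?_⟩
      · simp [f2 m hm, g2 m hm]
      · simp only [smul_eq_mul] at f3 g3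
        simp [f3 m hm hm', g3 m hm hm', add_mul]
    | hmon a c =>
      intro σ d
      by_cases hd : a.2.degree ≤ d
      -- Multiplication by a term shifts weight and x-degree, so the lift is taken at the shifted
      -- values. If the x-degree of the term exceeds `d`, the product has no terms of degree `d` and
      -- 0 serves.
      · obtain ⟨f, hf, f1, f2, f3⟩ := ih (σ - wdeg u a) (d - a.2.degree)
        refine ⟨toSer (monTerm a c) * f, I.mul_mem_left _ hf, ?_, fun m hm => ?_,
          fun m hm hm' => ?_⟩
        · have : (toSer (monTerm a c)).IsHomogeneous a.2.degree := by
            rw [toSer, monTerm, MvPolynomial.map_monomial]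
            exact MvPolynomial.isHomogeneous_monomial _ rfl
          simpa [Nat.add_sub_cancel' hd] using this.mul f1
        · rw [serCoeff_toSer_monTerm_mul]
          split_ifs with ham
          · have := wdeg_add u a (m - a)
            rw [add_tsub_cancel_of_le ham] at this
            rw [f2 (m - a) (by linarith), mul_zero]
          · rfl
        · rw [← serCoeff_toSer, smul_eq_mul, map_mul, serCoeff_toSer_monTerm_mul,
            serCoeff_toSer_monTerm_mul]
          split_ifs with ham
          · have h1 := wdeg_add u a (m - a)
            rw [add_tsub_cancel_of_le ham] at h1
            have h2 := congrArg Finsupp.degree (congrArg Prod.snd (add_tsub_cancel_of_le ham))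
            rw [Prod.snd_add, map_add] at h2
            rw [f3 (m - a) (by omega) (by linarith), serCoeff_toSer]
          · rfl
      · refine ⟨0, zero_mem _, MvPolynomial.isHomogeneous_zero _ _ _, by simp, fun m hm _ => ?_⟩
        rw [← serCoeff_toSer, smul_eq_mul, map_mul, serCoeff_toSer_monTerm_mul, if_neg,
          serCoeff_zero]
        intro ham
        have h2 := congrArg Finsupp.degree (congrArg Prod.snd (add_tsub_cancel_of_le ham))
        rw [Prod.snd_add, map_add] at h2
        omega

/-! ### Rankings, and the converse inclusions -/

/-- A fixed degree has finitely many x-exponents, and for each of them the weight tends to −∞ with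
the power of t. This allows monomials to be ranked by natural numbers. -/
theorem finite_degree_eq_wdeg_ge {w : Fin (n + 1) → ℝ} (hw : w 0 < 0) (d : ℕ) (K : ℝ) :
    {m : Mon n | m.2.degree = d ∧ K ≤ wdeg w m}.Finite := by
  have hfin := Finsupp.finite_of_degree_eq (σ := Fin n) d
  refine (hfin.biUnion (t := fun α => (fun b : ℕ => (b, α)) '' {b : ℕ | K ≤ wdeg w (b, α)})
    fun α _ => Set.Finite.image _ ?_).subset ?_
  · obtain ⟨N, hN⟩ := exists_nat_gt ((K - wdeg w (0, α)) / w 0)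
    refine (Set.finite_le_nat N).subset fun b hb => ?_
    by_contra hbN
    have h1 : (N : ℝ) < b := by simpa using hbN
    rw [div_lt_iff_of_neg hw] at hN
    have hb' : K ≤ wdeg w (b, α) := hb
    have h2 : wdeg w (b, α) = w 0 * b + wdeg w (0, α) := by simp [wdeg]
    nlinarith
  · rintro ⟨b, α⟩ ⟨h1, h2⟩
    exact Set.mem_biUnion h1 ⟨b, h2, rfl⟩

/-- Suppose that `J` is contained in `in_u(I)` and contains the top parts of the `x`-homogeneous
elements of `I` with respect to a ranking `ρ` of the monomials of a given `x`-degree which is finer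
than the `u`-weight. Then `J` contains `in_u(I)`. -/
theorem initialIdeal_le_of_le {u : Fin (n + 1) → ℝ} (hu : u 0 < 0) {I : Ideal (SerPoly R n)}
    (hI : IsXHomogeneous I) {J : Ideal (TPoly R n)} (hJ : J ≤ initialIdeal u I) (ρ : Mon n → ℕ)
    (hρ : ∀ x y : Mon n, x.2.degree = y.2.degree → ρ x = ρ y → wdeg u x = wdeg u y)
    (hJρ : ∀ f ∈ I, ∀ (s : Mon n), f.IsHomogeneous s.2.degree →
      (∀ x : Mon n, x.2.degree = s.2.degree → ρ x < ρ s → serCoeff f x = 0) →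
      ∀ T : Finset (Mon n), (∀ m, m ∈ T ↔ m.2.degree = s.2.degree ∧ ρ m = ρ s) →
      ∑ m ∈ T, monTerm m (serCoeff f m) ∈ J) :
    initialIdeal u I ≤ J := by
  classical
  have level (s : Mon n) : ∃ T : Finset (Mon n),
      ∀ m, m ∈ T ↔ m.2.degree = s.2.degree ∧ ρ m = ρ s := by
    have hfin : {m : Mon n | m.2.degree = s.2.degree ∧ ρ m = ρ s}.Finite :=
      (finite_degree_eq_wdeg_ge hu s.2.degree (wdeg u s)).subset
        fun m hm => ⟨hm.1, (hρ _ _ hm.1 hm.2).ge⟩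
    exact ⟨hfin.toFinset, by simp⟩
  have main : ∀ f ∈ I, ∀ s : Mon n, f.IsHomogeneous s.2.degree →
      (∀ x, wdeg u s < wdeg u x → serCoeff f x = 0) →
      ∀ T : Finset (Mon n), (∀ m, m ∈ T ↔ m.2.degree = s.2.degree ∧ ρ m = ρ s) →
      ∑ m ∈ T, monTerm m (serCoeff f m) ∈ J := by
    intro f hf s hfs hfu T hT
    let X := {m : Mon n // m.2.degree = s.2.degree}
    let N : AddSubgroup (X → R) :=
      { carrier := {c | ∃ g ∈ I, g.IsHomogeneous s.2.degree ∧ ∀ x : X, c x = serCoeff g x.1}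
        add_mem' := by
          rintro a b ⟨g, hg, g1, g2⟩ ⟨h, hh, h1, h2⟩
          exact ⟨g + h, add_mem hg hh, g1.add h1, fun x => by simp [g2, h2]⟩
        zero_mem' := ⟨0, zero_mem _, MvPolynomial.isHomogeneous_zero _ _ _, by simp⟩
        neg_mem' := by
          rintro a ⟨g, hg, g1, g2⟩
          exact ⟨-g, neg_mem hg, g1.neg, fun x => by simp [g2]⟩ }
    -- `N` consists of the coefficient families of the elements of `I` of one x-degree. The lifting
    -- hypothesis holds because ρ-top parts lie in `J`, hence in the initial ideal, whose elements
    -- lift to `I`.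
    obtain ⟨_, ⟨g, hg, g1, g2⟩, h1, h2⟩ := exists_mem_vanishing_above N (fun x => ρ x.1)
      (fun x => wdeg u x.1) (fun x y h => hρ _ _ (x.2.trans y.2.symm) h) (by
        rintro _ ⟨g, hg, g1, g2⟩ t ht
        obtain ⟨T', hT'⟩ := level t.1
        have hmem := hJ (hJρ g hg t.1 (by rw [t.2]; exact g1)
          (fun x hx h => by rw [← g2 ⟨x, hx.trans t.2⟩]; exact ht _ h) T' hT')
        obtain ⟨k, hk, k1, k2, k3⟩ :=
          exists_mem_of_mem_initialIdeal hu hI hmem (wdeg u t.1) s.2.degree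
        refine ⟨fun x => serCoeff k x.1, ⟨k, hk, k1, fun _ => rfl⟩, fun x hx => k2 _ hx,
          fun x hx => ⟨fun h => ?_, fun h => ?_⟩⟩
        · change serCoeff k x.1 = _
          rw [k3 _ x.2 hx, polyCoeff_sum_monTerm, if_pos ((hT' _).2 ⟨x.2.trans t.2.symm, h⟩), g2]
        · change serCoeff k x.1 = _
          rw [k3 _ x.2 hx, polyCoeff_sum_monTerm, if_neg fun h' => h ((hT' _).1 h').2])
      (f := fun x => serCoeff f x.1) ⟨f, hf, hfs, fun _ => rfl⟩ ⟨s, rfl⟩ (fun x hx => hfu _ hx)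
    have := hJρ g hg s g1 (fun x hx h => by rw [← g2 ⟨x, hx⟩]; exact h1 _ h) T hT
    convert this using 3 with m hm
    rw [hT] at hm
    rw [← g2 ⟨m, hm.1⟩]
    exact (h2 ⟨m, hm.1⟩ hm.2).symm
  refine Ideal.span_le.2 ?_
  rintro _ ⟨f, hf, rfl⟩
  have hfin := topExponents_serCoeff_finite u hu f
  rw [initialForm, finsum_mem_monTerm _ _ hfin.toFinset (by simp), SetLike.mem_coe,
    ← Finset.sum_fiberwise_of_maps_to (t := hfin.toFinset.image fun m => (m.2.degree, ρ m))
      (g := fun m => (m.2.degree, ρ m)) fun m hm => Finset.mem_image_of_mem _ hm]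
  refine sum_mem fun p hp => ?_
  obtain ⟨s, hs, rfl⟩ := Finset.mem_image.mp hp
  rw [Set.Finite.mem_toFinset] at hs
  obtain ⟨T, hT⟩ := level s
  have := main _ (hI.homogeneousComponent_mem hf s.2.degree) s
    (MvPolynomial.homogeneousComponent_isHomogeneous _ f) (fun x hx => by
      rw [serCoeff_homogeneousComponent]
      split_ifs
      · by_contra h
        exact absurd (hs.2 x h) (not_le.mpr hx)
      · rfl) T hT
  convert this using 1
  rw [sum_monTerm_congr_support (serCoeff f) _ T fun m hm => ?_]
  · refine Finset.sum_congr rfl fun m hm => ?_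
    rw [serCoeff_homogeneousComponent, if_pos ((hT m).1 hm).1]
  · rw [Finset.mem_filter, Set.Finite.mem_toFinset, hT, Prod.mk.injEq]
    refine and_iff_right_of_imp fun h => ⟨hm, fun y hy => ?_⟩
    rw [hρ _ _ h.1 h.2]
    exact hs.2 y hy

/-- The number of monomials of the same `x`-degree that are above a given monomial. -/
noncomputable def rank (r : Mon n → Mon n → Prop) (m : Mon n) : ℕ :=
  {x : Mon n | x.2.degree = m.2.degree ∧ r x m}.ncard

section rank

variable {r : Mon n → Mon n → Prop} {w : Fin (n + 1) → ℝ}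

/-- The set counted for `x` is strictly contained in that for `y`; compatibility with the `w`-weight
makes the latter finite. -/
theorem rank_lt_of_rel (hw : w 0 < 0) (hr : ∀ x y, r x y → wdeg w y ≤ wdeg w x)
    (irrefl : ∀ x, ¬ r x x) (trans : ∀ x y z, r x y → r y z → r x z) {x y : Mon n}
    (hd : x.2.degree = y.2.degree) (h : r x y) : rank r x < rank r y := by
  refine Set.ncard_lt_ncard ⟨fun z hz => ⟨hz.1.trans hd, trans _ _ _ hz.2 h⟩,
    fun hsub => irrefl x (hsub ⟨hd, h⟩).2⟩ ?_
  exact (finite_degree_eq_wdeg_ge hw y.2.degree (wdeg w y)).subset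
    fun z hz => ⟨hz.1, hr _ _ hz.2⟩

end rank

/-- The first two stages of the comparison in `>_{(w,v)}`. -/
def lexGT (w v : Fin (n + 1) → ℝ) (a b : Mon n) : Prop :=
  wdeg w b < wdeg w a ∨ wdeg w a = wdeg w b ∧ wdeg v b < wdeg v a

theorem rank_lexGT_lt {w v : Fin (n + 1) → ℝ} (hw : w 0 < 0) {x y : Mon n}
    (hd : x.2.degree = y.2.degree) (h : lexGT w v x y) :
    rank (lexGT w v) x < rank (lexGT w v) y := by
  refine rank_lt_of_rel hw ?_ ?_ ?_ hd h
  · rintro x y (h | ⟨h, -⟩) <;> linarith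
  · rintro x (h | ⟨-, h⟩) <;> exact lt_irrefl _ h
  · rintro x y z (h | ⟨h, h'⟩) (k | ⟨k, k'⟩)
    · left; linarith
    · left; linarith
    · left; linarith
    · right; constructor <;> linarith

theorem rank_lexGT_eq {w v : Fin (n + 1) → ℝ} (hw : w 0 < 0) {x y : Mon n}
    (hd : x.2.degree = y.2.degree) :
    rank (lexGT w v) x = rank (lexGT w v) y ↔ wdeg w x = wdeg w y ∧ wdeg v x = wdeg v y := by
  constructor
  · intro h
    have h1 : ¬ lexGT w v x y := fun h' => (rank_lexGT_lt hw hd h').ne h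
    have h2 : ¬ lexGT w v y x := fun h' => (rank_lexGT_lt hw hd.symm h').ne' h
    simp only [lexGT, not_or, not_and, not_lt] at h1 h2
    have hw' := le_antisymm h1.1 h2.1
    exact ⟨hw', le_antisymm (h1.2 hw') (h2.2 hw'.symm)⟩
  · rintro ⟨h1, h2⟩
    simp only [rank, lexGT, hd, h1, h2]

theorem rank_refine_lt (o : TLocalOrdering n) {w v : Fin (n + 1) → ℝ} (hw : w 0 < 0) {x y : Mon n}
    (hd : x.2.degree = y.2.degree) (h : (o.refine w v hw).gt x y) :
    rank (o.refine w v hw).gt x < rank (o.refine w v hw).gt y := by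
  refine rank_lt_of_rel hw ?_ (o.refine w v hw).irrefl (o.refine w v hw).trans hd h
  rintro x y (h | ⟨h, -⟩ | ⟨h, -⟩) <;> linarith

/-- If `in_v(in_w(I)) ⊆ in_{w+εv}(I)` then equality holds. -/
theorem initialIdeal_le_polyInitialIdeal {I : Ideal (SerPoly R n)} (hI : IsXHomogeneous I)
    {w v : Fin (n + 1) → ℝ} (hw : w 0 < 0) {ε : ℝ} (hz : (w + ε • v) 0 < 0)
    (hle : polyInitialIdeal v (initialIdeal w I) ≤ initialIdeal (w + ε • v) I) :
    initialIdeal (w + ε • v) I ≤ polyInitialIdeal v (initialIdeal w I) := by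
  classical
  refine initialIdeal_le_of_le hz hI hle (rank (lexGT w v)) (fun x y hd h => ?_)
    fun f hf s hfs hvan T hT => ?_
  · obtain ⟨h1, h2⟩ := (rank_lexGT_eq hw hd).1 h
    rw [wdeg_add_smul, wdeg_add_smul, h1, h2]
  have hnot (m : Mon n) (hm : serCoeff f m ≠ 0) : ¬ lexGT w v m s := fun h =>
    have hd := degree_eq_of_serCoeff_ne_zero hfs hm
    hm (hvan m hd (rank_lexGT_lt hw hd h))
  have hfin : {m : Mon n | m.2.degree = s.2.degree ∧ wdeg w m = wdeg w s}.Finite :=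
    (finite_degree_eq_wdeg_ge hw s.2.degree (wdeg w s)).subset fun m hm => ⟨hm.1, hm.2.ge⟩
  -- A lexicographic top part is obtained in two stages: the `w`-top part lies in in_w(I), and the
  -- `v`-top part of that is the sum over `T`.
  have hmem := sum_monTerm_mem_initialIdeal hf hfin.toFinset (wdeg w s)
    (fun m hm => not_lt.1 fun h => hnot m hm (Or.inl h)) fun m hm => by
      simp [degree_eq_of_serCoeff_ne_zero hfs hm]
  have := sum_monTerm_mem_polyInitialIdeal (u := v) hmem T (wdeg v s) (fun m hm => ?_) fun m hm => ?_
  · convert this using 3 with m hm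
    rw [hT] at hm
    have hm' := (rank_lexGT_eq hw hm.1).1 hm.2
    rw [polyCoeff_sum_monTerm, if_pos]
    simp [hm, hm']
  · rw [polyCoeff_sum_monTerm] at hm
    split_ifs at hm with h
    · rw [Set.Finite.mem_toFinset] at h
      exact not_lt.1 fun h' => hnot m hm (Or.inr ⟨h.2, h'⟩)
    · exact absurd rfl hm
  · rw [polyCoeff_sum_monTerm] at hm
    split_ifs at hm with h
    · rw [Set.Finite.mem_toFinset] at h
      rw [hT, and_iff_right h.1, rank_lexGT_eq hw h.1, and_iff_right h.2]
    · exact absurd rfl hm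

/-- If `lt(I) ⊆ in_u(I)` for an ordering of the form `>_{(w,v)}`, then equality holds. -/
theorem initialIdeal_le_leadingIdeal {I : Ideal (SerPoly R n)} (hI : IsXHomogeneous I)
    (o : TLocalOrdering n) {w v : Fin (n + 1) → ℝ} (hw : w 0 < 0) {u : Fin (n + 1) → ℝ}
    (hu : u 0 < 0) (hle : leadingIdeal (o.refine w v hw) I ≤ initialIdeal u I) :
    initialIdeal u I ≤ leadingIdeal (o.refine w v hw) I := by
  -- The ranking separates monomials of equal x-degree, so it is finer than every weight, and `u`
  -- need not be related to `w` and `v`.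
  have heq {x y : Mon n} (hd : x.2.degree = y.2.degree)
      (h : rank (o.refine w v hw).gt x = rank (o.refine w v hw).gt y) : x = y := by
    by_contra hxy
    rcases (o.refine w v hw).total x y hxy with h' | h'
    · exact (rank_refine_lt o hw hd h').ne h
    · exact (rank_refine_lt o hw hd.symm h').ne' h
  refine initialIdeal_le_of_le hu hI hle (rank (o.refine w v hw).gt)
    (fun x y hd h => by rw [heq hd h]) fun f hf s hfs hvan T hT => ?_
  obtain rfl : T = {s} := by
    ext m
    rw [hT, Finset.mem_singleton]
    exact ⟨fun h => heq h.1 h.2, by rintro rfl; simp⟩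
  by_cases h0 : serCoeff f s = 0
  · simp [h0]
  refine Ideal.subset_span ⟨f, hf, (finsum_mem_monTerm _ _ _ fun m hm => ?_).symm⟩
  have hs : ∀ m', serCoeff f m' ≠ 0 → m' ≠ s → (o.refine w v hw).gt s m' := by
    intro m' hm' hne
    have hd := degree_eq_of_serCoeff_ne_zero hfs hm'
    rcases (o.refine w v hw).total m' s hne with h | h
    · exact absurd (hvan m' hd (rank_refine_lt o hw hd h)) hm'
    · exact h
  rw [Finset.mem_singleton]
  constructor
  · rintro ⟨-, h⟩
    by_contra hne
    exact (o.refine w v hw).asymm (hs m hm hne) (h s h0 (Ne.symm hne))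
  · rintro rfl
    exact ⟨h0, hs⟩

/-! ### Inclusions for small perturbations -/

/-- For every element of `R⟦t⟧[x]` there are finitely many terms such that every other term is a
multiple by a positive power of `t` of the monomial of one of these. -/
theorem exists_finset_minimal (f : SerPoly R n) : ∃ B : Finset (Mon n),
    (∀ m ∈ B, serCoeff f m ≠ 0) ∧
      ∀ m, serCoeff f m ≠ 0 → m ∈ B ∨ ∃ b, b < m.1 ∧ (b, m.2) ∈ B := by
  classical
  refine ⟨f.support.image fun α => ((f.coeff α).order.toNat, α), ?_, ?_⟩
  · simp only [Finset.mem_image, MvPolynomial.mem_support_iff, forall_exists_index, and_imp]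
    rintro _ α hα rfl
    exact PowerSeries.coeff_order hα
  · rintro ⟨b, α⟩ h
    have hα : f.coeff α ≠ 0 := by
      intro h0
      simp [serCoeff, h0] at h
    have hmem : ((f.coeff α).order.toNat, α) ∈
        f.support.image fun α => ((f.coeff α).order.toNat, α) :=
      Finset.mem_image_of_mem _ (MvPolynomial.mem_support_iff.2 hα)
    have hle : (f.coeff α).order.toNat ≤ b := by
      have := PowerSeries.order_le _ h
      exact ENat.toNat_le_of_le_natCast this
    rcases hle.eq_or_lt with rfl | hlt
    · exact Or.inl hmem
    · exact Or.inr ⟨_, hlt, hmem⟩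

theorem eventually_zero_lt {w v : Fin (n + 1) → ℝ} (hw : w 0 < 0) :
    ∀ᶠ ε : ℝ in 𝓝[>] 0, (w + ε • v) 0 < 0 := by
  have : Tendsto (fun ε : ℝ => (w + ε • v) 0) (𝓝[>] 0) (𝓝 (w 0)) := by
    refine (Continuous.tendsto' ?_ _ _ (by simp)).mono_left nhdsWithin_le_nhds
    simp only [Pi.add_apply, Pi.smul_apply, smul_eq_mul]
    fun_prop
  exact this.eventually_lt_const hw

/-- A comparison of affine functions at `0`, with ties broken by the slopes. -/
theorem eventually_add_mul_lt {a b c d : ℝ} (h : a < b ∨ a = b ∧ c < d) :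
    ∀ᶠ ε : ℝ in 𝓝[>] 0, a + ε * c < b + ε * d := by
  rcases h with h | ⟨rfl, h⟩
  · have h1 : Tendsto (fun ε : ℝ => a + ε * c) (𝓝[>] 0) (𝓝 a) :=
      (Continuous.tendsto' (by fun_prop) _ _ (by simp)).mono_left nhdsWithin_le_nhds
    have h2 : Tendsto (fun ε : ℝ => b + ε * d) (𝓝[>] 0) (𝓝 b) :=
      (Continuous.tendsto' (by fun_prop) _ _ (by simp)).mono_left nhdsWithin_le_nhds
    exact h1.eventually_lt h2 h
  · filter_upwards [self_mem_nhdsWithin] with ε hε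
    have := mul_lt_mul_of_pos_left h (Set.mem_Ioi.1 hε)
    linarith

/-- Terms outside the finite set of t-minimal ones weigh strictly less than some t-minimal term,
once the perturbed weight of t is negative. Only finitely many strict inequalities are left, and
each holds for small ε. -/
theorem eventually_sum_monTerm_mem_initialIdeal {I : Ideal (SerPoly R n)} {w v : Fin (n + 1) → ℝ}
    (hw : w 0 < 0) {f : SerPoly R n} (hf : f ∈ I) (σ τ : ℝ)
    (h1 : ∀ m, serCoeff f m ≠ 0 → wdeg w m ≤ σ)
    (h2 : ∀ m, serCoeff f m ≠ 0 → wdeg w m = σ → wdeg v m ≤ τ) (T : Finset (Mon n))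
    (hT : ∀ m, serCoeff f m ≠ 0 → (m ∈ T ↔ wdeg w m = σ ∧ wdeg v m = τ)) :
    ∀ᶠ ε : ℝ in 𝓝[>] 0, ∑ m ∈ T, monTerm m (serCoeff f m) ∈ initialIdeal (w + ε • v) I := by
  obtain ⟨B, hB, hfB⟩ := exists_finset_minimal f
  have hev : ∀ᶠ ε : ℝ in 𝓝[>] 0, ∀ m ∈ B, ¬ (wdeg w m = σ ∧ wdeg v m = τ) →
      wdeg w m + ε * wdeg v m < σ + ε * τ := by
    rw [Filter.eventually_all_finset]
    intro m hm
    rw [Filter.eventually_imp_distrib_left]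
    intro hne
    apply eventually_add_mul_lt
    rcases (h1 m (hB m hm)).lt_or_eq with h | h
    · exact Or.inl h
    · exact Or.inr ⟨h, lt_of_le_of_ne (h2 m (hB m hm) h) fun h' => hne ⟨h, h'⟩⟩
  filter_upwards [hev, eventually_zero_lt (v := v) hw] with ε hε hz
  have hBle : ∀ m ∈ B, wdeg (w + ε • v) m ≤ σ + ε * τ := by
    intro m hm
    rw [wdeg_add_smul]
    by_cases h : wdeg w m = σ ∧ wdeg v m = τ
    · rw [h.1, h.2]
    · exact (hε m hm h).le
  have key : ∀ m, serCoeff f m ≠ 0 → wdeg (w + ε • v) m ≤ σ + ε * τ ∧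
      (wdeg (w + ε • v) m = σ + ε * τ → wdeg w m = σ ∧ wdeg v m = τ) := by
    intro m hm
    rcases hfB m hm with h | ⟨b, hb, h⟩
    · refine ⟨hBle m h, fun heq => ?_⟩
      by_contra hne
      rw [wdeg_add_smul] at heq
      exact (hε m h hne).ne heq
    · have : wdeg (w + ε • v) m < _ := (wdeg_anti hz hb m.2).trans_le (hBle _ h)
      exact ⟨this.le, fun heq => absurd heq this.ne⟩
  refine sum_monTerm_mem_initialIdeal hf T (σ + ε * τ) (fun m hm => (key m hm).1) fun m hm => ?_
  rw [hT m hm]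
  exact ⟨fun h => by rw [wdeg_add_smul, h.1, h.2], (key m hm).2⟩

/-- An element of in_w(I) need not be the `w`-initial form of one element of `I`, but its
bihomogeneous pieces lift individually. So in_v(h) is split by x-degree and `w`-weight, and its
finitely many pieces are treated separately. -/
theorem eventually_initialForm_mem_initialIdeal {I : Ideal (SerPoly R n)} (hI : IsXHomogeneous I)
    {w v : Fin (n + 1) → ℝ} (hw : w 0 < 0) {h : TPoly R n} (hh : h ∈ initialIdeal w I) :
    ∀ᶠ ε : ℝ in 𝓝[>] 0, initialForm v (polyCoeff h) ∈ initialIdeal (w + ε • v) I := by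
  classical
  have hfin := topExponents_polyCoeff_finite v h
  rw [initialForm, finsum_mem_monTerm _ _ hfin.toFinset (by simp),
    ← Finset.sum_fiberwise_of_maps_to (t := hfin.toFinset.image fun m => (m.2.degree, wdeg w m))
      (g := fun m => (m.2.degree, wdeg w m)) fun m hm => Finset.mem_image_of_mem _ hm]
  refine (((Filter.eventually_all_finset _).2 fun p hp => ?_).mono fun ε hε => sum_mem hε)
  obtain ⟨s, hs, rfl⟩ := Finset.mem_image.mp hp
  rw [Set.Finite.mem_toFinset] at hs
  obtain ⟨f, hf, f1, f2, f3⟩ := exists_mem_of_mem_initialIdeal hw hI hh (wdeg w s) s.2.degree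
  have hco (m : Mon n) (hm : serCoeff f m ≠ 0) (hms : wdeg w m = wdeg w s) :
      polyCoeff h m ≠ 0 := by
    rwa [← f3 m (degree_eq_of_serCoeff_ne_zero f1 hm) hms]
  refine (eventually_sum_monTerm_mem_initialIdeal hw hf (wdeg w s) (wdeg v s)
    (fun m hm => not_lt.1 fun h => hm (f2 m h)) (fun m hm hms => hs.2 m (hco m hm hms))
    (hfin.toFinset.filter fun m => (m.2.degree, wdeg w m) = (s.2.degree, wdeg w s))
    fun m hm => ?_).mono fun ε hε => ?_
  · rw [Finset.mem_filter, Set.Finite.mem_toFinset, Prod.mk.injEq]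
    constructor
    · rintro ⟨h1, -, h2⟩
      exact ⟨h2, le_antisymm (hs.2 m h1.1) (h1.2 s hs.1)⟩
    · rintro ⟨h1, h2⟩
      exact ⟨⟨hco m hm h1, fun y hy => h2 ▸ hs.2 y hy⟩, degree_eq_of_serCoeff_ne_zero f1 hm, h1⟩
  · convert hε using 3 with m hm
    rw [Finset.mem_filter, Prod.mk.injEq] at hm
    exact (f3 m hm.2.1 hm.2.2).symm

theorem exists_finset_leadingTerm_mem {I : Ideal (SerPoly R n)} (o : TLocalOrdering n)
    {f : SerPoly R n} (hf : f ∈ I) : ∃ D : Finset (Mon n × Mon n), (∀ p ∈ D, o.gt p.1 p.2) ∧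
      ∀ u : Fin (n + 1) → ℝ, u 0 < 0 → (∀ p ∈ D, wdeg u p.2 < wdeg u p.1) →
        leadingTerm o (serCoeff f) ∈ initialIdeal u I := by
  classical
  by_cases hm : ∃ m, serCoeff f m ≠ 0 ∧ ∀ m', serCoeff f m' ≠ 0 → m' ≠ m → o.gt m m'
  · obtain ⟨m, hm0, hm⟩ := hm
    obtain ⟨B, hB, hfB⟩ := exists_finset_minimal f
    refine ⟨(B.erase m).image fun b => (m, b), ?_, fun u hu hD => ?_⟩
    · simp only [Finset.mem_image, Finset.mem_erase, forall_exists_index, and_imp]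
      rintro _ b hbm hb rfl
      exact hm b (hB b hb) hbm
    have hlt : ∀ b ∈ B, b ≠ m → wdeg u b < wdeg u m := fun b hb hbm =>
      hD (m, b) (Finset.mem_image_of_mem _ (Finset.mem_erase.2 ⟨hbm, hb⟩))
    have key : ∀ x, serCoeff f x ≠ 0 → x ≠ m → wdeg u x < wdeg u m := by
      intro x hx hxm
      rcases hfB x hx with h | ⟨b, hb, h⟩
      · exact hlt x h hxm
      · refine (wdeg_anti hu hb x.2).trans_le ?_
        by_cases hbm : (b, x.2) = m
        · rw [hbm]
        · exact (hlt _ h hbm).le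
    have hlead : leadingTerm o (serCoeff f) = ∑ x ∈ {m}, monTerm x (serCoeff f x) := by
      refine finsum_mem_monTerm _ _ _ fun x hx => ?_
      rw [Finset.mem_singleton]
      constructor
      · rintro ⟨-, h⟩
        by_contra hne
        exact o.asymm (hm x hx hne) (h m hm0 (Ne.symm hne))
      · rintro rfl
        exact ⟨hm0, hm⟩
    rw [hlead]
    refine sum_monTerm_mem_initialIdeal hf {m} (wdeg u m) (fun x hx => ?_) fun x hx => ?_
    · by_cases h : x = m
      · rw [h]
      · exact (key x hx h).le
    · rw [Finset.mem_singleton]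
      refine ⟨fun h => by rw [h], fun h => ?_⟩
      by_contra hne
      exact (key x hx hne).ne h
  -- Without a greatest monomial the leading term is an empty sum, so no comparison is needed.
  · refine ⟨∅, by simp, fun u _ _ => ?_⟩
    have : leadingTerm o (serCoeff f) = ∑ x ∈ ∅, monTerm x (serCoeff f x) :=
      finsum_mem_monTerm _ _ _ fun x hx => by simpa using fun h => hm ⟨x, h⟩
    rw [this, Finset.sum_empty]
    exact zero_mem _

theorem exists_finset_leadingIdeal_le [IsNoetherianRing R] (I : Ideal (SerPoly R n))
    (o : TLocalOrdering n) : ∃ D : Finset (Mon n × Mon n), (∀ p ∈ D, o.gt p.1 p.2) ∧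
      ∀ u : Fin (n + 1) → ℝ, u 0 < 0 → (∀ p ∈ D, wdeg u p.2 < wdeg u p.1) →
        leadingIdeal o I ≤ initialIdeal u I := by
  classical
  obtain ⟨G, hG, hspan⟩ := (Submodule.fg_span_iff_fg_span_finset_subset _).1
    (IsNoetherian.noetherian (leadingIdeal o I))
  have : ∀ g ∈ G, ∃ D : Finset (Mon n × Mon n), (∀ p ∈ D, o.gt p.1 p.2) ∧
      ∀ u : Fin (n + 1) → ℝ, u 0 < 0 → (∀ p ∈ D, wdeg u p.2 < wdeg u p.1) →
        g ∈ initialIdeal u I := by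
    intro g hg
    obtain ⟨f, hf, rfl⟩ := hG hg
    exact exists_finset_leadingTerm_mem o hf
  choose! D hD hDu using this
  refine ⟨G.biUnion D, fun p hp => ?_, fun u hu hp => ?_⟩
  · obtain ⟨g, hg, hp⟩ := Finset.mem_biUnion.1 hp
    exact hD g hg p hp
  · change Submodule.span _ _ ≤ _
    rw [hspan, Submodule.span_le]
    exact fun g hg => hDu g hg u hu fun p hpD => hp p (Finset.mem_biUnion.2 ⟨g, hg, hpD⟩)

/-- The inclusion `in_v(in_w(I)) ⊆ in_{w+εv}(I)` for small `ε`. -/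
theorem eventually_polyInitialIdeal_le [IsNoetherianRing R] {I : Ideal (SerPoly R n)}
    (hI : IsXHomogeneous I) {w v : Fin (n + 1) → ℝ} (hw : w 0 < 0) :
    ∀ᶠ ε : ℝ in 𝓝[>] 0,
      polyInitialIdeal v (initialIdeal w I) ≤ initialIdeal (w + ε • v) I := by
  obtain ⟨G, hG, hspan⟩ := (Submodule.fg_span_iff_fg_span_finset_subset _).1
    (IsNoetherian.noetherian (polyInitialIdeal v (initialIdeal w I)))
  have : ∀ᶠ ε : ℝ in 𝓝[>] 0, ∀ g ∈ G, g ∈ initialIdeal (w + ε • v) I := by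
    rw [Filter.eventually_all_finset]
    intro g hg
    obtain ⟨h, hh, rfl⟩ := hG hg
    exact eventually_initialForm_mem_initialIdeal hI hw hh
  refine this.mono fun ε hε => ?_
  change Submodule.span _ _ ≤ _
  rw [hspan, Submodule.span_le]
  exact hε

/-- For small ε the weight w + εv respects the relevant comparisons up to ties, and the ties were
decided by `o`. A further shift by δu makes them strict, so w + εv is a limit of weights whose
initial ideal is the leading ideal. -/
theorem eventually_mem_groebnerCone_refine [IsNoetherianRing R] {I : Ideal (SerPoly R n)}
    (hI : IsXHomogeneous I) (o : TLocalOrdering n) {w v : Fin (n + 1) → ℝ} (hw : w 0 < 0) :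
    ∀ᶠ ε : ℝ in 𝓝[>] 0, w + ε • v ∈ groebnerCone (o.refine w v hw) I := by
  classical
  obtain ⟨D, hD, hDu⟩ := exists_finset_leadingIdeal_le I (o.refine w v hw)
  obtain ⟨u, hu⟩ := exists_wdeg_lt o (D.filter fun p => o.gt p.1 p.2) fun p hp =>
    (Finset.mem_filter.1 hp).2
  have hev : ∀ᶠ ε : ℝ in 𝓝[>] 0, ∀ p ∈ D, wdeg (w + ε • v) p.2 < wdeg (w + ε • v) p.1 ∨
      wdeg (w + ε • v) p.2 = wdeg (w + ε • v) p.1 ∧ wdeg u p.2 < wdeg u p.1 := by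
    rw [Filter.eventually_all_finset]
    intro p hp
    simp only [wdeg_add_smul]
    rcases hD p hp with h | ⟨h, h'⟩ | ⟨h, h', h''⟩
    · exact (eventually_add_mul_lt (Or.inl h)).mono fun _ => Or.inl
    · exact (eventually_add_mul_lt (Or.inr ⟨h.symm, h'⟩)).mono fun _ => Or.inl
    · exact Eventually.of_forall fun ε =>
        Or.inr ⟨by rw [h, h'], hu p (Finset.mem_filter.2 ⟨hp, h''⟩)⟩
  filter_upwards [hev, eventually_zero_lt (v := v) hw] with ε hε hz
  have hlim : Tendsto (fun δ : ℝ => (w + ε • v) + δ • u) (𝓝[>] 0) (𝓝 (w + ε • v)) :=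
    (Continuous.tendsto' (by fun_prop) _ _ (by simp)).mono_left nhdsWithin_le_nhds
  refine mem_closure_of_tendsto hlim ?_
  have hev' : ∀ᶠ δ : ℝ in 𝓝[>] 0, ∀ p ∈ D,
      wdeg ((w + ε • v) + δ • u) p.2 < wdeg ((w + ε • v) + δ • u) p.1 := by
    rw [Filter.eventually_all_finset]
    intro p hp
    simp only [wdeg_add_smul _ u]
    exact eventually_add_mul_lt (hε p hp)
  filter_upwards [hev', eventually_zero_lt (v := u) hz] with δ hδ h0
  have hle := hDu _ h0 hδ
  exact ⟨h0, le_antisymm (initialIdeal_le_leadingIdeal hI o hw h0 hle) hle⟩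

end GroebnerFan

/-! ### The theorem -/

theorem proposition5p4 {R : Type*} [CommRing R] [IsNoetherianRing R] {n : ℕ}
    (I : Ideal (GroebnerFan.SerPoly R n)) (hI : GroebnerFan.IsXHomogeneous I)
    (o : GroebnerFan.TLocalOrdering n) (w v : Fin (n + 1) → ℝ)
    (hw0 : w 0 < 0) (hw : w ∈ GroebnerFan.groebnerCone o I) :
    w ∈ GroebnerFan.groebnerCone o I ∩ GroebnerFan.groebnerCone (o.refine w v hw0) I ∧
    ∃ ε₀ : ℝ, 0 < ε₀ ∧ ∀ ε : ℝ, 0 < ε → ε < ε₀ →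
      (w + ε • v) 0 < 0 ∧
      w + ε • v ∈ GroebnerFan.groebnerCone (o.refine w v hw0) I ∧
      GroebnerFan.initialIdeal (w + ε • v) I =
        GroebnerFan.polyInitialIdeal v (GroebnerFan.initialIdeal w I) := by
  have hcone := GroebnerFan.eventually_mem_groebnerCone_refine hI o (v := v) hw0
  refine ⟨⟨hw, ?_⟩, ?_⟩
  -- The refined cone is closed and contains w + εv for all small ε > 0, hence also the limit `w`.
  · have hlim : Tendsto (fun ε : ℝ => w + ε • v) (𝓝[>] 0) (𝓝 w) :=
      (Continuous.tendsto' (by fun_prop) _ _ (by simp)).mono_left nhdsWithin_le_nhds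
    exact isClosed_closure.mem_of_tendsto hlim hcone
  · have hev := ((GroebnerFan.eventually_zero_lt (v := v) hw0).and hcone).and
      (GroebnerFan.eventually_polyInitialIdeal_le hI (v := v) hw0)
    obtain ⟨ε₀, hε₀, h⟩ := (mem_nhdsGT_iff_exists_Ioo_subset).1 hev
    refine ⟨ε₀, hε₀, fun ε h1 h2 => ?_⟩
    obtain ⟨⟨h3, h4⟩, h5⟩ := h ⟨h1, h2⟩
    exact ⟨h3, h4, le_antisymm
      (GroebnerFan.initialIdeal_le_polyInitialIdeal hI hw0 h3 h5) h5⟩
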